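/- Let $(S_t)_{t\ge 0}$ be a standard Gamma process on a probability space $(\Omega,\mathcal F,P)$: $S_0=0$ a.s., independent increments, $S_t-S_s\sim\mathrm{Gamma}(t-s,1)$ (shape $t-s$, rate $1$) for $s<t$, and almost all paths nondecreasing and right-continuous. Let $f:[0,\infty)\to[0,\infty)$ be measurable and integrable on every bounded interval, put $\lambda_t f=\int_0^t f(x)\,dx$, and assume $\lambda_t f\to\infty$ as $t\to\infty$. Let $$R_t=\frac{\int_0^t f\,dS}{\lambda_t f},\qquad b_t=\frac{f(t)}{\lambda_t f},\qquad v_t=\frac{\int_0^t f(x)^2\,dx}{(\lambda_t f)^2}\in[0,\infty],$$ where $\int_0^t f\,dS$ is the pathwise Lebesgue–Stieltjes integral over $(0,t]$. For $1\le p<\infty$, $f$ is said to satisfy orderly divergence (OD) in $L^p$ if $R_t\in L^p(P)$ for all large $t$ and $\|R_t-1\|_{L^p(P)}\to 0$ as $t\to\infty$. Theorem. Suppose that $b_t$ is bounded as $t\to\infty$, i.e. there are $C,t_0$ with $b_t\le C$ for all $t\ge t_0$. Then: (a) $f$ satisfies OD in $L^2$ if and only if $v_t\to 0$ as $t\to\infty$.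 (b) If $f$ satisfies OD in $L^2$, then it satisfies OD in $L^p$ for every real $p\ge 2$ such that $\int_0^t f(x)^p\,dx<\infty$ for all $t>0$. -/

import Mathlib

open MeasureTheory ProbabilityTheory Filter Topology Set
open scoped NNReal ENNReal

namespace OrderlyDivergence

/-- `S` is a standard Gamma process on `[0, ∞)`: it starts at `0`, has independent increments,
`S t - S s` is Gamma distributed with shape `t - s` and rate `1` for `s < t` (so `S 1` is
exponential with mean `1`), and almost all of its paths are nondecreasing and right-continuous. -/
structure IsGammaProcess {Ω : Type*} [MeasurableSpace Ω] (S : ℝ≥0 → Ω → ℝ) (P : Measure Ω) :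
    Prop where
  zero : ∀ᵐ ω ∂P, S 0 ω = 0
  indep : HasIndepIncrements S P
  law : ∀ s t : ℝ≥0, s < t →
    HasLaw (fun ω => S t ω - S s ω) (gammaMeasure ((t : ℝ) - (s : ℝ)) 1) P
  paths : ∀ᵐ ω ∂P, Monotone (fun t => S t ω) ∧
    ∀ t, ContinuousWithinAt (fun r => S r ω) (Ici t) t

/-- A nondecreasing right-continuous path on `[0, ∞)`, extended to `ℝ` by its value at `0`. -/
noncomputable def stieltjesOfPath (g : ℝ≥0 → ℝ) (hm : Monotone g)
    (hc : ∀ t, ContinuousWithinAt g (Ici t) t) : StieltjesFunction ℝ where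
  toFun x := g x.toNNReal
  mono' := fun _ _ h => hm (Real.toNNReal_le_toNNReal h)
  right_continuous' x :=
    (hc x.toNNReal).comp continuous_real_toNNReal.continuousWithinAt
      (fun _ hy => Real.toNNReal_le_toNNReal hy)

open Classical in
/-- The Lebesgue–Stieltjes measure `dg` of a path `g` on `[0, ∞)`, with `dg (s, t] = g t - g s`
for `0 ≤ s ≤ t` (and the zero measure if `g` is not nondecreasing and right-continuous). -/
noncomputable def pathMeasure (g : ℝ≥0 → ℝ) : Measure ℝ :=
  if h : Monotone g ∧ ∀ t, ContinuousWithinAt g (Ici t) t then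
    (stieltjesOfPath g h.1 h.2).measure
  else 0

/-- The pathwise stochastic integral `∫₀ᵗ f dS`. -/
noncomputable def gammaIntegral {Ω : Type*} (S : ℝ≥0 → Ω → ℝ) (f : ℝ → ℝ) (t : ℝ) (ω : Ω) : ℝ :=
  ∫ x in Ioc 0 t, f x ∂(pathMeasure (fun r => S r ω))

/-- `λ_t f = ∫₀ᵗ f(x) dx`. -/
noncomputable def lam (f : ℝ → ℝ) (t : ℝ) : ℝ := ∫ x in Ioc 0 t, f x

/-- The normalized integral `R_t = (∫₀ᵗ f dS) / λ_t f`. -/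
noncomputable def R {Ω : Type*} (S : ℝ≥0 → Ω → ℝ) (f : ℝ → ℝ) (t : ℝ) (ω : Ω) : ℝ :=
  gammaIntegral S f t ω / lam f t

/-- `b_t = f(t) / λ_t f`. -/
noncomputable def b (f : ℝ → ℝ) (t : ℝ) : ℝ := f t / lam f t

/-- `v_t = λ_t(f²) / (λ_t f)²`, with value `∞` if `λ_t(f²) = ∞`. -/
noncomputable def v (f : ℝ → ℝ) (t : ℝ) : ℝ≥0∞ :=
  (∫⁻ x in Ioc 0 t, ENNReal.ofReal (f x ^ 2)) / ENNReal.ofReal (lam f t ^ 2)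

/-- Orderly divergence in `L^p`: `R_t → 1` in `L^p(P)` as `t → ∞`. -/
def ODLp {Ω : Type*} [MeasurableSpace Ω] (S : ℝ≥0 → Ω → ℝ) (P : Measure Ω) (f : ℝ → ℝ)
    (p : ℝ) : Prop :=
  (∀ᶠ t in atTop, MemLp (R S f t) (ENNReal.ofReal p) P) ∧
    Tendsto (fun t => eLpNorm (fun ω => R S f t ω - 1) (ENNReal.ofReal p) P) atTop (𝓝 0)

end OrderlyDivergence

/-
Independence of increments and `x Γ_a(dx) = a Γ_{a+1}(dx)` give the size-biasing identity
`E[φ(S_T) ∫₀ᵀ ψ dS] = E[φ(S_{T+1})] ∫₀ᵀ ψ dx` and, by the same measure-matching argument applied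
to `E[W dS]` for other weights `W`, the variance of `∫₀ᵗ f dS`, which is `∫₀ᵗ f² dx`. Hence
`‖R_t - 1‖₂² = v_t`, which is (a).

For (b), a bounded `g` with `|g| ≤ c < 1` has `E exp (∫₀ᵗ g dS) = exp (-∫₀ᵗ log (1 - g) dx)`,
so `Y = ∫₀ᵗ g dS - λ_t g` satisfies `E cosh Y ≤ exp (∫₀ᵗ g² dx / (1 - c))`, and since
`|y|^p ≤ K (cosh y - 1)` for `p ≥ 2`, all these moments of `Y` are small once `∫₀ᵗ g² dx` is.
Fix a large `a`. The part of `R_t - 1` carried by `(0, a]` is a fixed variable of `L^p` divided by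
`λ_t f → ∞`. The part carried by `(a, t]` is of the form `Y` with `g = f / λ_t f`; there
`g x ≤ b f x` is bounded since `λ` is nondecreasing, and `∫ g² ≤ v_t → 0`. A rescaling of `g` turns
the bound into one below `1`.
-/

namespace OrderlyDivergence

section GammaMeasure

variable {a r : ℝ}

lemma measurable_gammaPDF (a r : ℝ) : Measurable (gammaPDF a r) :=
  (measurable_gammaPDFReal a r).ennreal_ofReal

lemma gammaPDF_mul_ofReal (ha : 0 < a) (hr : 0 < r) (x : ℝ) :
    gammaPDF a r x * ENNReal.ofReal x = ENNReal.ofReal (a / r) * gammaPDF (a + 1) r x := by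
  rcases lt_trichotomy x 0 with hx | rfl | hx
  · simp [gammaPDF_of_neg hx]
  · simp [gammaPDF_of_nonneg, Real.zero_rpow ha.ne']
  · have hΓ := (Real.Gamma_pos_of_pos ha).ne'
    rw [gammaPDF_of_nonneg hx.le, gammaPDF_of_nonneg hx.le, ← ENNReal.ofReal_mul' hx.le,
      ← ENNReal.ofReal_mul (by positivity), Real.Gamma_add_one ha.ne', Real.rpow_sub_one hx.ne',
      add_sub_cancel_right, Real.rpow_add_one hr.ne']
    congr 1
    field_simp

lemma lintegral_mul_ofReal_gammaMeasure (ha : 0 < a) (hr : 0 < r) {φ : ℝ → ℝ≥0∞}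
    (hφ : Measurable φ) :
    ∫⁻ x, φ x * ENNReal.ofReal x ∂gammaMeasure a r
      = ENNReal.ofReal (a / r) * ∫⁻ x, φ x ∂gammaMeasure (a + 1) r := by
  rw [gammaMeasure, gammaMeasure,
    lintegral_withDensity_eq_lintegral_mul _ (measurable_gammaPDF _ _) (by fun_prop),
    lintegral_withDensity_eq_lintegral_mul _ (measurable_gammaPDF _ _) hφ,
    ← lintegral_const_mul _ ((measurable_gammaPDF _ _).mul hφ)]
  refine lintegral_congr fun x => ?_
  rw [Pi.mul_apply, Pi.mul_apply, mul_left_comm, gammaPDF_mul_ofReal ha hr, mul_comm (φ x),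
    mul_assoc]

lemma gammaPDF_mul_ofReal_exp {θ : ℝ} (hr : 0 < r) (hθ : θ < r) (x : ℝ) :
    gammaPDF a r x * ENNReal.ofReal (Real.exp (θ * x))
      = ENNReal.ofReal ((1 - θ / r) ^ (-a)) * gammaPDF a (r - θ) x := by
  have hrθ : 0 < r - θ := sub_pos.2 hθ
  rcases lt_or_ge x 0 with hx | hx
  · simp [gammaPDF_of_neg hx]
  · have hexp : Real.exp (-((r - θ) * x)) = Real.exp (-(r * x)) * Real.exp (θ * x) := by
      rw [← Real.exp_add]
      ring_nf
    rw [gammaPDF_of_nonneg hx, gammaPDF_of_nonneg hx, ← ENNReal.ofReal_mul' (by positivity),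
      one_sub_div hr.ne', Real.rpow_neg (by positivity), ← ENNReal.ofReal_mul (by positivity),
      Real.div_rpow hrθ.le hr.le, hexp]
    congr 1
    have : (r - θ) ^ a ≠ 0 := by positivity
    field_simp

lemma mgf_id_gammaMeasure {θ : ℝ} (ha : 0 < a) (hr : 0 < r) (hθ : θ < r) :
    mgf id (gammaMeasure a r) θ = (1 - θ / r) ^ (-a) := by
  have hbase : 0 ≤ 1 - θ / r := sub_nonneg.2 ((div_le_one hr).2 hθ.le)
  rw [mgf, integral_eq_lintegral_of_nonneg_ae (ae_of_all _ fun x => (Real.exp_pos _).le)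
    (by fun_prop), gammaMeasure,
    lintegral_withDensity_eq_lintegral_mul _ (measurable_gammaPDF _ _) (by fun_prop)]
  simp only [Pi.mul_apply, id, gammaPDF_mul_ofReal_exp hr hθ]
  rw [lintegral_const_mul _ (measurable_gammaPDF _ _),
    lintegral_gammaPDF_eq_one ha (sub_pos.2 hθ), mul_one,
    ENNReal.toReal_ofReal (Real.rpow_nonneg hbase _)]

lemma integrable_exp_mul_gammaMeasure {θ : ℝ} (ha : 0 < a) (hr : 0 < r) (hθ : θ < r) :
    Integrable (fun x => Real.exp (θ * x)) (gammaMeasure a r) := by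
  refine Integrable.of_integral_ne_zero ?_
  have hbase : 0 < 1 - θ / r := sub_pos.2 ((div_lt_one hr).2 hθ)
  exact (mgf_id_gammaMeasure ha hr hθ).trans_ne (Real.rpow_pos_of_pos hbase _).ne'

lemma integrable_abs_rpow_gammaMeasure {p : ℝ} (ha : 0 < a) (hr : 0 < r) (hp : 0 ≤ p) :
    Integrable (fun x => |x| ^ p) (gammaMeasure a r) :=
  integrable_rpow_abs_of_integrable_exp_mul (X := id) (half_pos hr).ne'
    (integrable_exp_mul_gammaMeasure ha hr (half_lt_self hr))
    (integrable_exp_mul_gammaMeasure ha hr (by linarith)) hp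

end GammaMeasure

section RandomMeasure

lemma aemeasurable_measure_of_isPiSystem {Ω α : Type*} [MeasurableSpace Ω]
    [mα : MeasurableSpace α] {P : Measure Ω} {κ : Ω → Measure α} {C : Set (Set α)}
    (hC : C.Countable) (hgen : mα = MeasurableSpace.generateFrom C) (hpi : IsPiSystem C)
    (hfin : ∀ᵐ ω ∂P, IsFiniteMeasure (κ ω)) (hmeas : ∀ s ∈ C, AEMeasurable (fun ω => κ ω s) P)
    (huniv : AEMeasurable (fun ω => κ ω univ) P) : AEMeasurable κ P := by
  have hversions : ∀ᵐ ω ∂P, ∀ s, ∀ hs : s ∈ C, κ ω s = (hmeas s hs).mk _ ω :=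
    (ae_ball_iff hC).2 fun s hs => (hmeas s hs).ae_eq_mk
  obtain ⟨G, hGae, hGm, hG⟩ :=
    (hfin.and (huniv.ae_eq_mk.and hversions)).exists_measurable_mem
  have hindicator (s : Set α) :
      (fun ω => G.indicator κ ω s) = G.indicator fun ω => κ ω s := by
    ext ω
    by_cases hω : ω ∈ G <;> simp [hω]
  have : ∀ ω, IsFiniteMeasure (G.indicator κ ω) := fun ω => by
    by_cases hω : ω ∈ G
    · simpa [hω] using (hG ω hω).1
    · simpa [hω] using isFiniteMeasureZero
  refine ⟨G.indicator κ, Measurable.measure_of_isPiSystem hgen hpi (fun s hs => ?_) ?_,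
    ?_⟩
  · rw [hindicator, indicator_congr fun ω hω => (hG ω hω).2.2 s hs]
    exact (hmeas s hs).measurable_mk.indicator hGm
  · rw [hindicator, indicator_congr fun ω hω => (hG ω hω).2.1]
    exact huniv.measurable_mk.indicator hGm
  · filter_upwards [hGae] with ω hω
    rw [indicator_of_mem hω]

end RandomMeasure

section PathMeasure

variable {g : ℝ≥0 → ℝ} (hm : Monotone g) (hc : ∀ t, ContinuousWithinAt g (Ici t) t)

include hm hc

lemma pathMeasure_Ioc (s t : ℝ) :
    pathMeasure g (Ioc s t) = ENNReal.ofReal (g t.toNNReal - g s.toNNReal) := by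
  rw [pathMeasure, dif_pos ⟨hm, hc⟩, StieltjesFunction.measure_Ioc]
  rfl

lemma pathMeasure_restrict_Iic (T s : ℝ) :
    (pathMeasure g).restrict (Ioc 0 T) (Iic s)
      = ENNReal.ofReal (g (min T s).toNNReal - g 0) := by
  rw [Measure.restrict_apply measurableSet_Iic, inter_comm, Ioc_inter_Iic, pathMeasure_Ioc hm hc,
    Real.toNNReal_zero]

lemma isFiniteMeasure_pathMeasure_restrict (s t : ℝ) :
    IsFiniteMeasure ((pathMeasure g).restrict (Ioc s t)) :=
  ⟨by rw [Measure.restrict_apply_univ, pathMeasure_Ioc hm hc]; exact ENNReal.ofReal_lt_top⟩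

end PathMeasure

/-- The pathwise integral `∫₀ᵗ φ dS` of a `[0, ∞]`-valued function: the counterpart of
`gammaIntegral` for which moments can be computed before integrability is known. -/
noncomputable def gammaLIntegral {Ω : Type*} (S : ℝ≥0 → Ω → ℝ) (φ : ℝ → ℝ≥0∞) (t : ℝ) (ω : Ω) :
    ℝ≥0∞ :=
  ∫⁻ x in Ioc 0 t, φ x ∂pathMeasure fun r => S r ω

namespace IsGammaProcess

variable {Ω : Type*} [MeasurableSpace Ω] {P : Measure Ω} {S : ℝ≥0 → Ω → ℝ}

lemma hasLaw (hS : IsGammaProcess S P) {t : ℝ≥0} (ht : 0 < t) :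
    HasLaw (S t) (gammaMeasure t 1) P := by
  have h := hS.law 0 t ht
  rw [NNReal.coe_zero, sub_zero] at h
  refine h.congr ?_
  filter_upwards [hS.zero] with ω hω
  rw [hω, sub_zero]

lemma isProbabilityMeasure (hS : IsGammaProcess S P) : IsProbabilityMeasure P :=
  have := isProbabilityMeasure_gammaMeasure (a := ((1 : ℝ≥0) : ℝ)) (by simp) one_pos
  (hS.hasLaw one_pos).isProbabilityMeasure

lemma aemeasurable (hS : IsGammaProcess S P) (t : ℝ≥0) : AEMeasurable (S t) P := by
  rcases eq_zero_or_pos t with rfl | ht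
  · exact (aemeasurable_const (b := (0 : ℝ))).congr (EventuallyEq.symm hS.zero)
  · exact (hS.hasLaw ht).aemeasurable

lemma ae_nonneg (hS : IsGammaProcess S P) : ∀ᵐ ω ∂P, ∀ t, 0 ≤ S t ω := by
  filter_upwards [hS.zero, hS.paths] with ω h0 hω t
  exact h0.ge.trans (hω.1 zero_le)

lemma ae_isFiniteMeasure_pathMeasure (hS : IsGammaProcess S P) (T : ℝ) :
    ∀ᵐ ω ∂P, IsFiniteMeasure ((pathMeasure fun r => S r ω).restrict (Ioc 0 T)) :=
  hS.paths.mono fun _ hω => isFiniteMeasure_pathMeasure_restrict hω.1 hω.2 0 T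

lemma pathMeasure_Ioc_ae_eq (hS : IsGammaProcess S P) (s t : ℝ≥0) :
    (fun ω => pathMeasure (fun r => S r ω) (Ioc s t))
      =ᵐ[P] fun ω => ENNReal.ofReal (S t ω - S s ω) := by
  filter_upwards [hS.paths] with ω hω
  rw [pathMeasure_Ioc hω.1 hω.2, Real.toNNReal_coe, Real.toNNReal_coe]

lemma pathMeasure_restrict_Iic_ae_eq (hS : IsGammaProcess S P) (T s : ℝ) :
    (fun ω => (pathMeasure fun r => S r ω).restrict (Ioc 0 T) (Iic s))
      =ᵐ[P] fun ω => ENNReal.ofReal (S (min T s).toNNReal ω) := by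
  filter_upwards [hS.paths, hS.zero] with ω hω h0
  rw [pathMeasure_restrict_Iic hω.1 hω.2, h0, sub_zero]

lemma aemeasurable_pathMeasure (hS : IsGammaProcess S P) (T : ℝ) :
    AEMeasurable (fun ω => (pathMeasure fun r => S r ω).restrict (Ioc 0 T)) P := by
  refine aemeasurable_measure_of_isPiSystem (countable_iUnion fun _ => countable_singleton _)
    Real.borel_eq_generateFrom_Iic_rat Real.isPiSystem_Iic_rat
    (hS.ae_isFiniteMeasure_pathMeasure T) (fun s hs => ?_) ?_
  · obtain ⟨q, rfl⟩ := mem_iUnion.1 hs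
    exact (hS.aemeasurable _).ennreal_ofReal.congr (hS.pathMeasure_restrict_Iic_ae_eq T q).symm
  · refine ((hS.aemeasurable T.toNNReal).sub (hS.aemeasurable 0)).ennreal_ofReal.congr ?_
    filter_upwards [hS.paths] with ω hω
    rw [Measure.restrict_apply_univ, pathMeasure_Ioc hω.1 hω.2, Real.toNNReal_zero, Pi.sub_apply]

lemma aemeasurable_gammaLIntegral (hS : IsGammaProcess S P) {φ : ℝ → ℝ≥0∞} (hφ : Measurable φ)
    (T : ℝ) : AEMeasurable (gammaLIntegral S φ T) P :=
  (Measure.measurable_lintegral hφ).comp_aemeasurable (hS.aemeasurable_pathMeasure T)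

section Moments

lemma lintegral_mul_gammaLIntegral (hS : IsGammaProcess S P) {W : Ω → ℝ≥0∞}
    (hW : AEMeasurable W P) {T : ℝ≥0} {ν : Measure ℝ} (hν : ν (Ioc 0 T) ≠ ∞)
    (h : ∀ s ≤ T, ∫⁻ ω, W ω * ENNReal.ofReal (S s ω) ∂P = ν (Ioc 0 s))
    {φ : ℝ → ℝ≥0∞} (hφ : Measurable φ) :
    ∫⁻ ω, W ω * gammaLIntegral S φ T ω ∂P = ∫⁻ x in Ioc 0 (T : ℝ), φ x ∂ν := by
  let κ : Ω → Measure ℝ := fun ω => (pathMeasure fun r => S r ω).restrict (Ioc 0 T)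
  have hκP : AEMeasurable κ P := hS.aemeasurable_pathMeasure T
  have hκ : AEMeasurable κ (P.withDensity W) :=
    hκP.mono_ac (withDensity_absolutelyContinuous _ _)
  have : IsFiniteMeasure (ν.restrict (Ioc 0 T)) :=
    ⟨by rw [Measure.restrict_apply_univ]; exact hν.lt_top⟩
  have hIic (s : ℝ) : ν.restrict (Ioc 0 T) (Iic s) = (P.withDensity W).bind κ (Iic s) := by
    have hκs : AEMeasurable (fun ω => κ ω (Iic s)) P :=
      (Measure.measurable_coe measurableSet_Iic).comp_aemeasurable hκP
    have hle : (min (T : ℝ) s).toNNReal ≤ T := Real.toNNReal_le_iff_le_coe.2 (min_le_left _ _)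
    have hIoc : Ioc 0 (max (min (T : ℝ) s) 0) = Ioc 0 (min (T : ℝ) s) := by
      ext x
      simp only [mem_Ioc, le_max_iff]
      grind
    calc ν.restrict (Ioc 0 T) (Iic s)
        = ν (Ioc 0 (min (T : ℝ) s).toNNReal) := by
          rw [Measure.restrict_apply measurableSet_Iic, inter_comm, Ioc_inter_Iic,
            Real.coe_toNNReal', hIoc]
      _ = ∫⁻ ω, W ω * κ ω (Iic s) ∂P := by
          rw [← h _ hle]
          refine lintegral_congr_ae ?_
          filter_upwards [hS.pathMeasure_restrict_Iic_ae_eq T s] with ω hω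
          rw [hω]
      _ = (P.withDensity W).bind κ (Iic s) := by
          rw [Measure.bind_apply measurableSet_Iic hκ,
            lintegral_withDensity_eq_lintegral_mul₀ hW hκs]
          rfl
  rw [Measure.ext_of_Iic _ _ hIic, Measure.lintegral_bind hκ hφ.aemeasurable]
  exact (lintegral_withDensity_eq_lintegral_mul₀ hW (hS.aemeasurable_gammaLIntegral hφ T)).symm

lemma lintegral_comp_prodMk_sub (hS : IsGammaProcess S P) {r t : ℝ≥0} (hr : 0 < r) (hrt : r < t)
    {ψ : ℝ × ℝ → ℝ≥0∞} (hψ : Measurable ψ) :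
    ∫⁻ ω, ψ (S r ω, S t ω - S r ω) ∂P
      = ∫⁻ y, ∫⁻ x, ψ (x, y) ∂gammaMeasure r 1 ∂gammaMeasure (t - r) 1 := by
  have hrt' : (0 : ℝ) < t - r := sub_pos.2 hrt
  have := isProbabilityMeasure_gammaMeasure (NNReal.coe_pos.2 hr) one_pos
  have := isProbabilityMeasure_gammaMeasure hrt' one_pos
  have := hS.isProbabilityMeasure
  have hindep : IndepFun (S r) (S t - S r) P := hS.indep.indepFun_eval_sub zero_le hrt.le hS.zero
  have hpair := (indepFun_iff_hasLaw_prodMk_prod (hS.hasLaw hr) (hS.law r t hrt)).1 hindep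
  rw [hpair.lintegral_comp hψ.aemeasurable, lintegral_prod_symm' _ hψ]

lemma lintegral_comp_mul_ofReal (hS : IsGammaProcess S P) {r t : ℝ≥0} (hrt : r ≤ t)
    {φ : ℝ → ℝ≥0∞} (hφ : Measurable φ) :
    ∫⁻ ω, φ (S t ω) * ENNReal.ofReal (S r ω) ∂P = r * ∫⁻ ω, φ (S (t + 1) ω) ∂P := by
  rcases eq_zero_or_pos r with rfl | hr
  · have hzero : ∀ᵐ ω ∂P, φ (S t ω) * ENNReal.ofReal (S 0 ω) = 0 := by
      filter_upwards [hS.zero] with ω h0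
      rw [h0, ENNReal.ofReal_zero, mul_zero]
    rw [lintegral_congr_ae hzero, lintegral_zero, ENNReal.coe_zero, zero_mul]
  have hr' : (0 : ℝ) < r := hr
  rcases hrt.eq_or_lt with rfl | hrt
  · rw [(hS.hasLaw hr).lintegral_comp (f := fun x => φ x * ENNReal.ofReal x) (by fun_prop),
      lintegral_mul_ofReal_gammaMeasure hr' one_pos hφ,
      (hS.hasLaw (by positivity)).lintegral_comp hφ.aemeasurable]
    simp
  · have hshift := hS.lintegral_comp_prodMk_sub (r := r + 1) (t := t + 1) (by positivity)
      (by gcongr) (ψ := fun p => φ (p.1 + p.2)) (by fun_prop)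
    have hbias := hS.lintegral_comp_prodMk_sub hr hrt
      (ψ := fun p => φ (p.1 + p.2) * ENNReal.ofReal p.1) (by fun_prop)
    simp only [add_sub_cancel, NNReal.coe_add, NNReal.coe_one, add_sub_add_right_eq_sub]
      at hshift hbias
    have := isProbabilityMeasure_gammaMeasure (a := (r : ℝ) + 1) (by positivity) one_pos
    rw [hbias, hshift, ← lintegral_const_mul _ (Measurable.lintegral_prod_left'
      (f := fun p : ℝ × ℝ => φ (p.1 + p.2)) (by fun_prop))]
    refine lintegral_congr fun y => ?_
    rw [lintegral_mul_ofReal_gammaMeasure hr' one_pos (φ := fun x => φ (x + y)) (by fun_prop),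
      div_one, ENNReal.ofReal_coe_nnreal]

lemma lintegral_ofReal (hS : IsGammaProcess S P) (t : ℝ≥0) :
    ∫⁻ ω, ENNReal.ofReal (S t ω) ∂P = t := by
  have := hS.isProbabilityMeasure
  simpa using hS.lintegral_comp_mul_ofReal le_rfl (t := t) (φ := fun _ => 1) measurable_const

lemma lintegral_ofReal_mul_ofReal (hS : IsGammaProcess S P) (r s : ℝ≥0) :
    ∫⁻ ω, ENNReal.ofReal (S r ω) * ENNReal.ofReal (S s ω) ∂P = r * s + min r s := by
  wlog hsr : s ≤ r generalizing r s
  · simp_rw [mul_comm (ENNReal.ofReal (S r _)), this s r (le_of_not_ge hsr), mul_comm, min_comm]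
  rw [hS.lintegral_comp_mul_ofReal hsr ENNReal.measurable_ofReal, hS.lintegral_ofReal,
    min_eq_right hsr]
  push_cast
  ring

lemma lintegral_comp_mul_gammaLIntegral (hS : IsGammaProcess S P) (T : ℝ≥0) {φ : ℝ → ℝ≥0∞}
    (hφ : Measurable φ) (hφT : ∫⁻ ω, φ (S (T + 1) ω) ∂P ≠ ∞) {ψ : ℝ → ℝ≥0∞} (hψ : Measurable ψ) :
    ∫⁻ ω, φ (S T ω) * gammaLIntegral S ψ T ω ∂P
      = (∫⁻ ω, φ (S (T + 1) ω) ∂P) * ∫⁻ x in Ioc 0 (T : ℝ), ψ x := by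
  rw [hS.lintegral_mul_gammaLIntegral (ν := (∫⁻ ω, φ (S (T + 1) ω) ∂P) • volume)
    (W := fun ω => φ (S T ω)) (hφ.comp_aemeasurable (hS.aemeasurable T))
    (ENNReal.mul_ne_top hφT (by simp)) (fun s hs => ?_) hψ, Measure.restrict_smul,
    lintegral_smul_measure, smul_eq_mul]
  rw [hS.lintegral_comp_mul_ofReal hs hφ, mul_comm]
  simp

lemma lintegral_gammaLIntegral (hS : IsGammaProcess S P) (T : ℝ≥0) {φ : ℝ → ℝ≥0∞}
    (hφ : Measurable φ) : ∫⁻ ω, gammaLIntegral S φ T ω ∂P = ∫⁻ x in Ioc 0 (T : ℝ), φ x := by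
  have := hS.isProbabilityMeasure
  simpa using
    hS.lintegral_comp_mul_gammaLIntegral T (φ := fun _ => 1) measurable_const (by simp) hφ

lemma lintegral_gammaLIntegral_mul_ofReal (hS : IsGammaProcess S P) {r T : ℝ≥0} (hrT : r ≤ T)
    {φ : ℝ → ℝ≥0∞} (hφ : Measurable φ) :
    ∫⁻ ω, gammaLIntegral S φ T ω * ENNReal.ofReal (S r ω) ∂P
      = r * (∫⁻ x in Ioc 0 (T : ℝ), φ x) + ∫⁻ x in Ioc 0 (r : ℝ), φ x := by
  simp_rw [mul_comm (gammaLIntegral S φ T _)]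
  rw [hS.lintegral_mul_gammaLIntegral
    (ν := (r : ℝ≥0∞) • volume + volume.restrict (Ioc 0 (r : ℝ)))
    (hS.aemeasurable r).ennreal_ofReal ?_ (fun s _ => ?_) hφ, Measure.restrict_add,
    lintegral_add_measure, Measure.restrict_smul, lintegral_smul_measure, smul_eq_mul,
    Measure.restrict_restrict measurableSet_Ioc,
    inter_eq_right.2 (Ioc_subset_Ioc_right (NNReal.coe_le_coe.2 hrT))]
  · simp only [Measure.coe_add, Pi.add_apply, Measure.smul_apply, smul_eq_mul]
    exact ENNReal.add_ne_top.2 ⟨ENNReal.mul_ne_top (by simp) (by simp), measure_ne_top _ _⟩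
  · rw [hS.lintegral_ofReal_mul_ofReal, Measure.add_apply, Measure.smul_apply, smul_eq_mul,
      Measure.restrict_apply measurableSet_Ioc, Ioc_inter_Ioc, Real.volume_Ioc, Real.volume_Ioc]
    simp [← NNReal.coe_min, min_comm]

lemma lintegral_gammaLIntegral_sq (hS : IsGammaProcess S P) {T : ℝ≥0} {φ : ℝ → ℝ≥0∞}
    (hφ : Measurable φ) (hfin : ∫⁻ x in Ioc 0 (T : ℝ), φ x ≠ ∞) :
    ∫⁻ ω, gammaLIntegral S φ T ω ^ 2 ∂P
      = (∫⁻ x in Ioc 0 (T : ℝ), φ x) ^ 2 + ∫⁻ x in Ioc 0 (T : ℝ), φ x ^ 2 := by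
  simp_rw [pow_two]
  rw [hS.lintegral_mul_gammaLIntegral
    (ν := (∫⁻ x in Ioc 0 (T : ℝ), φ x) • volume + volume.withDensity φ)
    (hS.aemeasurable_gammaLIntegral hφ T) ?_ (fun s hs => ?_) hφ, Measure.restrict_add,
    lintegral_add_measure, Measure.restrict_smul, lintegral_smul_measure, smul_eq_mul,
    restrict_withDensity measurableSet_Ioc, lintegral_withDensity_eq_lintegral_mul _ hφ hφ]
  · rfl
  · rw [Measure.add_apply, Measure.smul_apply, smul_eq_mul, withDensity_apply _ measurableSet_Ioc]
    exact ENNReal.add_ne_top.2 ⟨ENNReal.mul_ne_top hfin (by simp), hfin⟩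
  · rw [hS.lintegral_gammaLIntegral_mul_ofReal hs hφ, Measure.add_apply,
      Measure.smul_apply, smul_eq_mul, withDensity_apply _ measurableSet_Ioc, Real.volume_Ioc,
      sub_zero, ENNReal.ofReal_coe_nnreal, mul_comm]

end Moments

end IsGammaProcess

section ToReal

lemma setIntegral_eq_toReal_setLIntegral {α : Type*} [MeasurableSpace α] {μ : Measure α} {s : Set α}
    (hs : MeasurableSet s) {g : α → ℝ} (hg : Measurable g) (hg0 : ∀ x ∈ s, 0 ≤ g x) :
    ∫ x in s, g x ∂μ = (∫⁻ x in s, ENNReal.ofReal (g x) ∂μ).toReal :=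
  integral_eq_lintegral_of_nonneg_ae ((ae_restrict_iff' hs).2 (ae_of_all _ hg0))
    hg.aestronglyMeasurable

lemma enorm_toReal_sub_toReal_sq_add {x y : ℝ≥0∞} (hx : x ≠ ∞) (hy : y ≠ ∞) :
    ‖x.toReal - y.toReal‖ₑ ^ 2 + 2 * y * x = x ^ 2 + y ^ 2 := by
  lift x to ℝ≥0 using hx
  lift y to ℝ≥0 using hy
  have hsq : ‖(x : ℝ) - y‖ₑ ^ 2 = ENNReal.ofReal (((x : ℝ) - y) ^ 2) := by
    rw [Real.enorm_eq_ofReal_abs, ← ENNReal.ofReal_pow (abs_nonneg _), sq_abs]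
  rw [ENNReal.coe_toReal, ENNReal.coe_toReal, hsq, ← ENNReal.toReal_eq_toReal_iff' (by finiteness)
    (by finiteness), ENNReal.toReal_add (by finiteness) (by finiteness),
    ENNReal.toReal_add (by finiteness) (by finiteness), ENNReal.toReal_ofReal (sq_nonneg _)]
  simp only [ENNReal.toReal_mul, ENNReal.toReal_pow, ENNReal.coe_toReal, ENNReal.toReal_ofNat]
  ring

end ToReal

/-- The compensated integral `∫₀ᵗ f dS - λ_t f`, the centering of `∫₀ᵗ f dS`. -/
noncomputable def compensatedIntegral {Ω : Type*} (S : ℝ≥0 → Ω → ℝ) (f : ℝ → ℝ) (t : ℝ) (ω : Ω) :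
    ℝ :=
  gammaIntegral S f t ω - lam f t

lemma compensatedIntegral_const_mul {Ω : Type*} (S : ℝ≥0 → Ω → ℝ) (a : ℝ) (f : ℝ → ℝ) (t : ℝ) :
    compensatedIntegral S (fun x => a * f x) t = a • compensatedIntegral S f t := by
  ext ω
  simp only [compensatedIntegral, gammaIntegral, lam, integral_const_mul, ← mul_sub,
    Pi.smul_apply, smul_eq_mul]

lemma compensatedIntegral_neg {Ω : Type*} (S : ℝ≥0 → Ω → ℝ) (f : ℝ → ℝ) (t : ℝ) (ω : Ω) :
    compensatedIntegral S (-f) t ω = -compensatedIntegral S f t ω := by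
  simp only [compensatedIntegral, gammaIntegral, lam, Pi.neg_apply, integral_neg, neg_sub_neg,
    neg_sub]

lemma R_sub_one_eq_smul_compensatedIntegral {Ω : Type*} (S : ℝ≥0 → Ω → ℝ) {f : ℝ → ℝ} {t : ℝ}
    (ht : lam f t ≠ 0) :
    (fun ω => R S f t ω - 1) = (lam f t)⁻¹ • compensatedIntegral S f t := by
  ext ω
  rw [R, Pi.smul_apply, compensatedIntegral, smul_eq_mul]
  field_simp

namespace IsGammaProcess

variable {Ω : Type*} [MeasurableSpace Ω] {P : Measure Ω} {S : ℝ≥0 → Ω → ℝ} {T : ℝ≥0}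

section Pathwise

lemma ae_ae_pathMeasure (hS : IsGammaProcess S P) {p : ℝ → Prop}
    (h : ∀ᵐ x ∂volume.restrict (Ioc 0 (T : ℝ)), p x) :
    ∀ᵐ ω ∂P, ∀ᵐ x ∂(pathMeasure fun r => S r ω).restrict (Ioc 0 (T : ℝ)), p x := by
  obtain ⟨N, hN, hNm, hN0⟩ := exists_measurable_superset_of_null (ae_iff.1 h)
  have hmean := hS.lintegral_gammaLIntegral T ((measurable_one (α := ℝ≥0∞)).indicator hNm)
  rw [lintegral_indicator_one hNm, hN0, lintegral_eq_zero_iff'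
    (hS.aemeasurable_gammaLIntegral (measurable_one.indicator hNm) _)] at hmean
  filter_upwards [hmean] with ω hω
  rw [gammaLIntegral, lintegral_indicator_one hNm] at hω
  exact measure_mono_null hN hω

lemma ae_integrableOn_pathMeasure (hS : IsGammaProcess S P) {g : ℝ → ℝ} (hg : Measurable g)
    (hgi : IntegrableOn g (Ioc 0 T)) :
    ∀ᵐ ω ∂P, IntegrableOn g (Ioc 0 T) (pathMeasure fun r => S r ω) := by
  have hmean := hS.lintegral_gammaLIntegral T hg.enorm
  filter_upwards [ae_lt_top' (hS.aemeasurable_gammaLIntegral hg.enorm T)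
    (hmean.trans_ne hgi.hasFiniteIntegral.ne)] with ω hω
  exact ⟨hg.aestronglyMeasurable, hω⟩

lemma aemeasurable_gammaIntegral (hS : IsGammaProcess S P) {g : ℝ → ℝ} (hg : Measurable g)
    (hgi : IntegrableOn g (Ioc 0 T)) : AEMeasurable (gammaIntegral S g T) P := by
  refine AEMeasurable.congr
    ((hS.aemeasurable_gammaLIntegral hg.ennreal_ofReal T).ennreal_toReal.sub
      (hS.aemeasurable_gammaLIntegral hg.neg.ennreal_ofReal T).ennreal_toReal) ?_
  filter_upwards [hS.ae_integrableOn_pathMeasure hg hgi] with ω hω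
  exact (integral_eq_lintegral_pos_part_sub_lintegral_neg_part hω).symm

lemma aemeasurable_compensatedIntegral (hS : IsGammaProcess S P) {g : ℝ → ℝ} (hg : Measurable g)
    (hgi : IntegrableOn g (Ioc 0 T)) : AEMeasurable (compensatedIntegral S g T) P :=
  (hS.aemeasurable_gammaIntegral hg hgi).sub_const _

end Pathwise

section Variance

lemma lintegral_enorm_compensatedIntegral_sq (hS : IsGammaProcess S P) {g : ℝ → ℝ}
    (hg : Measurable g) (hg0 : ∀ x ∈ Ioc 0 (T : ℝ), 0 ≤ g x) (hgi : IntegrableOn g (Ioc 0 T)) :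
    ∫⁻ ω, ‖compensatedIntegral S g T ω‖ₑ ^ 2 ∂P
      = ∫⁻ x in Ioc 0 (T : ℝ), ENNReal.ofReal (g x ^ 2) := by
  have := hS.isProbabilityMeasure
  set X := gammaLIntegral S (fun x => ENNReal.ofReal (g x)) T
  set m := ∫⁻ x in Ioc 0 (T : ℝ), ENNReal.ofReal (g x)
  have hX : AEMeasurable X P := hS.aemeasurable_gammaLIntegral hg.ennreal_ofReal T
  have hm : m ≠ ∞ := hgi.setLIntegral_lt_top.ne
  have hmean : ∫⁻ ω, X ω ∂P = m := hS.lintegral_gammaLIntegral T hg.ennreal_ofReal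
  have hsq : ∫⁻ ω, X ω ^ 2 ∂P = m ^ 2 + ∫⁻ x in Ioc 0 (T : ℝ), ENNReal.ofReal (g x ^ 2) := by
    rw [hS.lintegral_gammaLIntegral_sq hg.ennreal_ofReal hm]
    congr 1
    exact setLIntegral_congr_fun measurableSet_Ioc fun x hx =>
      (ENNReal.ofReal_pow (hg0 x hx) 2).symm
  have hexpand : ∀ᵐ ω ∂P,
      ‖compensatedIntegral S g T ω‖ₑ ^ 2 + 2 * m * X ω = X ω ^ 2 + m ^ 2 := by
    filter_upwards [ae_lt_top' hX (hmean.trans_ne hm)] with ω hω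
    rw [compensatedIntegral, gammaIntegral, lam,
      setIntegral_eq_toReal_setLIntegral measurableSet_Ioc hg hg0,
      setIntegral_eq_toReal_setLIntegral measurableSet_Ioc hg hg0]
    exact enorm_toReal_sub_toReal_sq_add hω.ne hm
  have htotal := lintegral_congr_ae hexpand
  rw [lintegral_add_right' _ (hX.const_mul _), lintegral_const_mul'' _ hX, hmean,
    lintegral_add_right' _ aemeasurable_const, hsq, lintegral_const, measure_univ,
    mul_one] at htotal
  refine (ENNReal.add_left_inj (ENNReal.mul_ne_top (ENNReal.mul_ne_top (by simp) hm) hm)).1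
    (htotal.trans ?_)
  ring

end Variance

end IsGammaProcess

section StepFunctions

lemma setIntegral_comp_ceil_div {μ : Measure ℝ} {δ : ℝ} (hδ : 0 < δ) (h : ℕ → ℝ) (n : ℕ)
    (hμ : μ (Ioc 0 (n * δ)) ≠ ∞) :
    ∫ x in Ioc 0 (n * δ), h ⌈x / δ⌉₊ ∂μ
      = ∑ k ∈ Finset.range n, h (k + 1) * μ.real (Ioc (k * δ) ((k + 1 : ℕ) * δ)) := by
  have hmono : Monotone fun k : ℕ => (k : ℝ) * δ := fun i j hij => by dsimp only; gcongr
  have hcell (k : ℕ) : EqOn (fun x => h ⌈x / δ⌉₊) (fun _ => h (k + 1))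
      (Ioc (k * δ) ((k + 1 : ℕ) * δ)) := fun x hx => by
    dsimp only
    rw [(Nat.ceil_eq_iff k.succ_ne_zero).2 ⟨(lt_div_iff₀ hδ).2 hx.1, (div_le_iff₀ hδ).2 hx.2⟩]
  have hunion : Ioc 0 (n * δ) = ⋃ k ∈ Finset.range n, Ioc (k * δ) ((k + 1 : ℕ) * δ) := by
    have := hmono.biUnion_Ico_Ioc_map_succ 0 n
    simp only [Nat.cast_zero, zero_mul, mem_Ico, zero_le, true_and, Nat.succ_eq_succ] at this
    simpa only [Finset.mem_range] using this.symm
  have hfin : ∀ k ∈ Finset.range n, μ (Ioc (k * δ) ((k + 1 : ℕ) * δ)) ≠ ∞ := fun k hk =>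
    measure_ne_top_of_subset (hunion ▸ subset_biUnion_of_mem (u := fun k : ℕ =>
      Ioc (k * δ) ((k + 1 : ℕ) * δ)) hk) hμ
  rw [hunion, integral_biUnion_finset (s := fun k : ℕ => Ioc (k * δ) ((k + 1 : ℕ) * δ)) _
    (fun _ _ => measurableSet_Ioc) (hmono.pairwise_disjoint_on_Ioc_succ.set_pairwise _) fun k hk =>
      (integrableOn_const (hfin k hk)).congr_fun (hcell k).symm measurableSet_Ioc]
  refine Finset.sum_congr rfl fun k _ => ?_
  rw [setIntegral_congr_fun measurableSet_Ioc (hcell k), setIntegral_const, smul_eq_mul, mul_comm]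

/-- The step function whose value on each cell `((k - 1) δ, k δ]`, `k ≥ 1`, is the average of `g`
over that cell. The cell is written as a closed ball because the Lebesgue differentiation theorem
is stated for averages over balls. -/
noncomputable def cellAverage (g : ℝ → ℝ) (δ x : ℝ) : ℝ :=
  ⨍ y in Metric.closedBall ((⌈x / δ⌉₊ - 1 / 2) * δ) (δ / 2), g y

lemma norm_average_le_of_norm_le_const {α E : Type*} [MeasurableSpace α] [NormedAddCommGroup E]
    [NormedSpace ℝ E] {μ : Measure α} {g : α → E} {C : ℝ} (hC : 0 ≤ C)
    (hg : ∀ᵐ x ∂μ, ‖g x‖ ≤ C) : ‖⨍ x, g x ∂μ‖ ≤ C := by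
  have hmass : ((μ univ)⁻¹ • μ) univ ≤ 1 := ENNReal.inv_mul_le_one _
  have : IsFiniteMeasure ((μ univ)⁻¹ • μ) := ⟨hmass.trans_lt ENNReal.one_lt_top⟩
  calc ‖⨍ x, g x ∂μ‖ ≤ C * ((μ univ)⁻¹ • μ).real univ :=
        norm_integral_le_of_norm_le_const (Measure.ae_smul_measure hg _)
    _ ≤ C := mul_le_of_le_one_right hC (ENNReal.toReal_le_of_le_ofReal zero_le_one (by simp))

lemma abs_cellAverage_le {g : ℝ → ℝ} {c : ℝ} (hg : ∀ x, |g x| ≤ c) (δ x : ℝ) :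
    |cellAverage g δ x| ≤ c :=
  norm_average_le_of_norm_le_const (g := g) ((abs_nonneg _).trans (hg 0)) (ae_of_all _ hg)

lemma measurable_cellAverage (g : ℝ → ℝ) (δ : ℝ) : Measurable (cellAverage g δ) :=
  (measurable_from_nat (f := fun k : ℕ =>
    ⨍ y in Metric.closedBall ((k - 1 / 2) * δ) (δ / 2), g y)).comp
    (Nat.measurable_ceil.comp (measurable_id.div_const δ))

lemma mem_closedBall_cell {δ x : ℝ} (hδ : 0 < δ) (hx : 0 < x) :
    x ∈ Metric.closedBall ((⌈x / δ⌉₊ - 1 / 2) * δ) (δ / 2) := by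
  have hle : x ≤ ⌈x / δ⌉₊ * δ := (div_le_iff₀ hδ).1 (Nat.le_ceil _)
  have hlt : ⌈x / δ⌉₊ * δ < x + δ := by
    have := mul_lt_mul_of_pos_right (Nat.ceil_lt_add_one (div_pos hx hδ).le) hδ
    rwa [add_mul, div_mul_cancel₀ _ hδ.ne', one_mul] at this
  rw [Metric.mem_closedBall, Real.dist_eq, abs_le]
  constructor <;> linarith

lemma ae_tendsto_cellAverage {g : ℝ → ℝ} (hg : LocallyIntegrable g) {δ : ℕ → ℝ}
    (hδ : Tendsto δ atTop (𝓝[>] 0)) :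
    ∀ᵐ x, 0 < x → Tendsto (fun n => cellAverage g (δ n) x) atTop (𝓝 (g x)) := by
  have hhalf : Tendsto (fun n => δ n / 2) atTop (𝓝[>] 0) := by
    refine tendsto_nhdsWithin_iff.2 ⟨?_, ?_⟩
    · simpa using (tendsto_nhds_of_tendsto_nhdsWithin hδ).div_const 2
    · filter_upwards [hδ.eventually self_mem_nhdsWithin] with n hn using half_pos hn
  filter_upwards [IsUnifLocDoublingMeasure.ae_tendsto_average volume hg 1] with x hx hx0
  refine hx _ _ hhalf ?_
  filter_upwards [hδ.eventually self_mem_nhdsWithin] with n hn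
  rw [one_mul]
  exact mem_closedBall_cell hn hx0

end StepFunctions

section Logarithm

lemma abs_log_one_sub_le {x c : ℝ} (hx : |x| ≤ c) (hc : c < 1) :
    |Real.log (1 - x)| ≤ c / (1 - c) := by
  have h := Real.abs_log_sub_add_sum_range_le (hx.trans_lt hc) 0
  simp only [Finset.range_zero, Finset.sum_empty, zero_add, pow_one] at h
  have hc0 : 0 ≤ c := (abs_nonneg x).trans hx
  have : 0 < 1 - c := sub_pos.2 hc
  exact h.trans (by gcongr)

lemma neg_log_one_sub_le {x c : ℝ} (hx : |x| ≤ c) (hc : c < 1) :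
    -Real.log (1 - x) ≤ x + x ^ 2 / (1 - c) := by
  have h := Real.abs_log_sub_add_sum_range_le (hx.trans_lt hc) 1
  simp only [Finset.sum_range_one, zero_add, pow_one, Nat.cast_zero, div_one, one_add_one_eq_two,
    sq_abs] at h
  have : 0 < 1 - c := sub_pos.2 hc
  have hle : x ^ 2 / (1 - |x|) ≤ x ^ 2 / (1 - c) := by gcongr
  linarith [(abs_le.1 h).1]

lemma tendsto_integral_log_one_sub {α : Type*} [MeasurableSpace α] {μ : Measure α}
    [IsFiniteMeasure μ] {c : ℝ} (hc : c < 1) {G : ℕ → α → ℝ} {g : α → ℝ}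
    (hGm : ∀ n, Measurable (G n)) (hG : ∀ n x, |G n x| ≤ c) (hg : ∀ x, |g x| ≤ c)
    (hlim : ∀ᵐ x ∂μ, Tendsto (fun n => G n x) atTop (𝓝 (g x))) :
    Tendsto (fun n => ∫ x, Real.log (1 - G n x) ∂μ) atTop (𝓝 (∫ x, Real.log (1 - g x) ∂μ)) := by
  refine tendsto_integral_of_dominated_convergence (fun _ => c / (1 - c))
    (fun n => ((hGm n).const_sub 1).log.aestronglyMeasurable) (integrable_const _)
    (fun n => ae_of_all _ fun x => abs_log_one_sub_le (hG n x) hc) ?_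
  filter_upwards [hlim] with x hx
  have hpos : 0 < 1 - g x := sub_pos.2 ((le_abs_self _).trans_lt ((hg x).trans_lt hc))
  exact (hx.const_sub 1).log hpos.ne'

end Logarithm

namespace IsGammaProcess

variable {Ω : Type*} [MeasurableSpace Ω] {P : Measure Ω} {S : ℝ≥0 → Ω → ℝ} {T : ℝ≥0}

section Laplace

lemma mgf_sub_eval (hS : IsGammaProcess S P) {s t : ℝ≥0} (hst : s < t) {θ : ℝ} (hθ : θ < 1) :
    mgf (fun ω => S t ω - S s ω) P θ = (1 - θ) ^ (-(t - s : ℝ)) := by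
  have hlaw := hS.law s t hst
  rw [← mgf_id_map hlaw.aemeasurable, hlaw.map_eq,
    mgf_id_gammaMeasure (sub_pos.2 (NNReal.coe_lt_coe.2 hst)) one_pos hθ, div_one]

lemma integrable_exp_mul_eval (hS : IsGammaProcess S P) (t : ℝ≥0) {θ : ℝ} (hθ : θ < 1) :
    Integrable (fun ω => Real.exp (θ * S t ω)) P := by
  have := hS.isProbabilityMeasure
  rcases eq_zero_or_pos t with rfl | ht
  · refine (integrable_const (1 : ℝ)).congr ?_
    filter_upwards [hS.zero] with ω h0
    rw [h0, mul_zero, Real.exp_zero]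
  · have hlaw := hS.hasLaw ht
    exact (hlaw.map_eq ▸ integrable_exp_mul_gammaMeasure (NNReal.coe_pos.2 ht) one_pos hθ
      : Integrable (fun x => Real.exp (θ * x)) (P.map (S t))).comp_aemeasurable hlaw.aemeasurable

lemma ae_abs_gammaIntegral_le (hS : IsGammaProcess S P) {g : ℝ → ℝ} {c : ℝ}
    (hg : ∀ x, |g x| ≤ c) (T : ℝ≥0) : ∀ᵐ ω ∂P, |gammaIntegral S g T ω| ≤ c * S T ω := by
  filter_upwards [hS.pathMeasure_Ioc_ae_eq 0 T, hS.zero, hS.ae_nonneg] with ω hω h0 hpos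
  rw [h0, sub_zero, NNReal.coe_zero] at hω
  have hlt : pathMeasure (fun r => S r ω) (Ioc 0 T) < ∞ := hω ▸ ENNReal.ofReal_lt_top
  refine (norm_setIntegral_le_of_norm_le_const (f := g) hlt fun x _ => hg x).trans_eq ?_
  rw [measureReal_def, hω, ENNReal.toReal_ofReal (hpos T)]

lemma gammaIntegral_comp_ceil_div_ae_eq (hS : IsGammaProcess S P) {δ : ℝ≥0} (hδ : 0 < δ)
    (h : ℕ → ℝ) (n : ℕ) :
    gammaIntegral S (fun x => h ⌈x / δ⌉₊) (n * δ) =ᵐ[P]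
      ∑ k ∈ Finset.range n, fun ω => h (k + 1) * (S ((k + 1 : ℕ) * δ) ω - S (k * δ) ω) := by
  filter_upwards [ae_all_iff.2 fun k : ℕ => hS.pathMeasure_Ioc_ae_eq (k * δ) ((k + 1 : ℕ) * δ),
    hS.pathMeasure_Ioc_ae_eq 0 (n * δ), hS.paths] with ω hcell htotal hω
  push_cast at hcell htotal
  rw [gammaIntegral, setIntegral_comp_ceil_div (NNReal.coe_pos.2 hδ) h n
    (htotal.trans_ne ENNReal.ofReal_ne_top), Finset.sum_apply]
  refine Finset.sum_congr rfl fun k _ => ?_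
  push_cast
  rw [measureReal_def, hcell, ENNReal.toReal_ofReal (sub_nonneg.2 (hω.1 (by gcongr; simp)))]

lemma integral_exp_gammaIntegral_comp_ceil_div (hS : IsGammaProcess S P) {δ : ℝ≥0} (hδ : 0 < δ)
    {h : ℕ → ℝ} (hh : ∀ k, h k < 1) (n : ℕ) :
    ∫ ω, Real.exp (gammaIntegral S (fun x => h ⌈x / δ⌉₊) (n * δ) ω) ∂P
      = Real.exp (-∫ x in Ioc 0 (n * δ : ℝ), Real.log (1 - h ⌈x / δ⌉₊)) := by
  let X : ℕ → Ω → ℝ := fun k ω => h (k + 1) * (S ((k + 1 : ℕ) * δ) ω - S (k * δ) ω)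
  have hmono : Monotone fun k : ℕ => (k : ℝ≥0) * δ := fun i j hij => by dsimp only; gcongr
  have hindep : iIndepFun X P :=
    (hS.indep.nat hmono).comp (fun k x => h (k + 1) * x) fun k => by fun_prop
  have hX (k : ℕ) : AEMeasurable (X k) P :=
    ((hS.aemeasurable _).sub (hS.aemeasurable _)).const_mul _
  have hmgf (k : ℕ) : mgf (X k) P 1 = Real.exp (-(Real.log (1 - h (k + 1)) * δ)) := by
    have hlt : (k : ℝ≥0) * δ < (k + 1 : ℕ) * δ := by gcongr; simp
    rw [mgf_const_mul, mul_one, hS.mgf_sub_eval hlt (hh _),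
      Real.rpow_def_of_pos (sub_pos.2 (hh _))]
    congr 1
    push_cast
    ring
  calc ∫ ω, Real.exp (gammaIntegral S (fun x => h ⌈x / δ⌉₊) (n * δ) ω) ∂P
      = mgf (∑ k ∈ Finset.range n, X k) P 1 := by
        refine integral_congr_ae ?_
        filter_upwards [hS.gammaIntegral_comp_ceil_div_ae_eq hδ h n] with ω hω
        rw [hω, one_mul]
    _ = Real.exp (-∑ k ∈ Finset.range n, Real.log (1 - h (k + 1)) * δ) := by
        rw [hindep.mgf_sum₀ hX, ← Finset.sum_neg_distrib, Real.exp_sum]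
        exact Finset.prod_congr rfl fun k _ => hmgf k
    _ = Real.exp (-∫ x in Ioc 0 (n * δ : ℝ), Real.log (1 - h ⌈x / δ⌉₊)) := by
        rw [setIntegral_comp_ceil_div (NNReal.coe_pos.2 hδ) (fun k => Real.log (1 - h k)) n
          (by rw [Real.volume_Ioc]; exact ENNReal.ofReal_ne_top)]
        congr 2
        refine Finset.sum_congr rfl fun k _ => ?_
        rw [Real.volume_real_Ioc_of_le (by gcongr; simp), ← sub_mul]
        simp

lemma tendsto_integral_exp_gammaIntegral (hS : IsGammaProcess S P) {c : ℝ} (hc : c < 1)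
    {G : ℕ → ℝ → ℝ} {g : ℝ → ℝ} (hGm : ∀ n, Measurable (G n)) (hG : ∀ n x, |G n x| ≤ c)
    (hlim : ∀ᵐ x ∂volume.restrict (Ioc 0 (T : ℝ)), Tendsto (fun n => G n x) atTop (𝓝 (g x))) :
    Tendsto (fun n => ∫ ω, Real.exp (gammaIntegral S (G n) T ω) ∂P) atTop
      (𝓝 (∫ ω, Real.exp (gammaIntegral S g T ω) ∂P)) := by
  have hint (n : ℕ) : IntegrableOn (G n) (Ioc 0 T) :=
    Measure.integrableOn_of_bounded (by simp) (hGm n).aestronglyMeasurable (ae_of_all _ (hG n))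
  refine tendsto_integral_of_dominated_convergence (fun ω => Real.exp (c * S T ω))
    (fun n => (hS.aemeasurable_gammaIntegral (hGm n) (hint n)).exp.aestronglyMeasurable)
    (hS.integrable_exp_mul_eval T hc) (fun n => ?_) ?_
  · filter_upwards [hS.ae_abs_gammaIntegral_le (hG n) T] with ω hω
    rw [Real.norm_eq_abs, Real.abs_exp]
    exact Real.exp_le_exp.2 ((le_abs_self _).trans hω)
  · filter_upwards [hS.ae_ae_pathMeasure hlim, hS.ae_isFiniteMeasure_pathMeasure T]
      with ω hω hfin
    exact (Real.continuous_exp.tendsto _).comp (tendsto_integral_of_dominated_convergence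
      (fun _ => c) (fun n => (hGm n).aestronglyMeasurable) (integrable_const c)
      (fun n => ae_of_all _ (hG n)) hω)

lemma integral_exp_gammaIntegral (hS : IsGammaProcess S P) {c : ℝ} (hc : c < 1) {g : ℝ → ℝ}
    (hgm : Measurable g) (hg : ∀ x, |g x| ≤ c) (T : ℝ≥0) :
    ∫ ω, Real.exp (gammaIntegral S g T ω) ∂P
      = Real.exp (-∫ x in Ioc 0 (T : ℝ), Real.log (1 - g x)) := by
  rcases eq_zero_or_pos T with rfl | hT
  · have := hS.isProbabilityMeasure
    simp [gammaIntegral]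
  let δ : ℕ → ℝ≥0 := fun n => T / (n + 1 : ℕ)
  let G : ℕ → ℝ → ℝ := fun n => cellAverage g (δ n)
  have hδ (n : ℕ) : 0 < δ n := by positivity
  have hδlim : Tendsto (fun n => (δ n : ℝ)) atTop (𝓝[>] 0) := by
    refine tendsto_nhdsWithin_iff.2 ⟨?_, Eventually.of_forall hδ⟩
    simpa [δ, Function.comp_def] using
      (tendsto_const_div_atTop_nhds_zero_nat (T : ℝ)).comp (tendsto_add_atTop_nat 1)
  have hGm (n : ℕ) : Measurable (G n) := measurable_cellAverage g _
  have hG (n : ℕ) (x : ℝ) : |G n x| ≤ c := abs_cellAverage_le hg _ x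
  have hgloc : LocallyIntegrable g := (locallyIntegrable_const c).mono hgm.aestronglyMeasurable
    (ae_of_all _ fun x => (hg x).trans (le_abs_self c))
  have hlim : ∀ᵐ x ∂volume.restrict (Ioc 0 (T : ℝ)), Tendsto (fun n => G n x) atTop (𝓝 (g x)) :=
    (ae_restrict_iff' measurableSet_Ioc).2 <|
      (ae_tendsto_cellAverage hgloc hδlim).mono fun x hx hxT => hx hxT.1
  have hstep (n : ℕ) : ∫ ω, Real.exp (gammaIntegral S (G n) T ω) ∂P
      = Real.exp (-∫ x in Ioc 0 (T : ℝ), Real.log (1 - G n x)) := by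
    have hT : ((n + 1 : ℕ) : ℝ) * δ n = T := by
      simp only [δ]
      push_cast
      field_simp
    rw [← hT]
    exact hS.integral_exp_gammaIntegral_comp_ceil_div (hδ n)
      (h := fun k => ⨍ y in Metric.closedBall ((k - 1 / 2) * (δ n : ℝ)) (δ n / 2), g y)
      (fun k => (abs_lt.1 ((norm_average_le_of_norm_le_const (g := g)
        ((abs_nonneg _).trans (hg 0)) (ae_of_all _ hg)).trans_lt hc)).2) (n + 1)
  refine tendsto_nhds_unique (hS.tendsto_integral_exp_gammaIntegral hc hGm hG hlim) ?_
  simp only [hstep]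
  exact (Real.continuous_exp.tendsto _).comp
    (tendsto_integral_log_one_sub hc hGm hG hg hlim).neg

end Laplace

end IsGammaProcess

section Moments

lemma eLpNorm_ofReal_rpow {α ε : Type*} [MeasurableSpace α] [TopologicalSpace ε]
    [ContinuousENorm ε] {μ : Measure α} (f : α → ε) {p : ℝ} (hp : 0 < p) :
    eLpNorm f (ENNReal.ofReal p) μ ^ p = ∫⁻ x, ‖f x‖ₑ ^ p ∂μ := by
  have h := eLpNorm_nnreal_pow_eq_lintegral (f := f) (μ := μ) (Real.toNNReal_pos.2 hp).ne'
  rwa [Real.coe_toNNReal p hp.le] at h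

lemma tendsto_rpow_nhds_zero_iff {ι : Type*} {l : Filter ι} {u : ι → ℝ≥0∞} {p : ℝ} (hp : 0 < p) :
    Tendsto (fun i => u i ^ p) l (𝓝 0) ↔ Tendsto u l (𝓝 0) := by
  simpa [Function.comp_def, hp] using
    ((ENNReal.orderIsoRpow p hp).toHomeomorph.isInducing.tendsto_nhds_iff (f := u) (l := l)
      (y := 0)).symm

lemma lintegral_rpow_le_measure_univ_rpow_mul {α : Type*} [MeasurableSpace α] {μ : Measure α}
    {φ : α → ℝ≥0∞} (hφ : AEMeasurable φ μ) {p : ℝ} (hp : 1 ≤ p) :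
    (∫⁻ x, φ x ∂μ) ^ p ≤ μ univ ^ (p - 1) * ∫⁻ x, φ x ^ p ∂μ := by
  have hp0 : 0 < p := one_pos.trans_le hp
  have hexp : 0 ≤ 1 - 1 / p := sub_nonneg.2 ((div_le_one hp0).2 hp)
  have holder := ENNReal.lintegral_mul_norm_pow_le (hφ.pow_const p)
    (aemeasurable_const (b := (1 : ℝ≥0∞))) (one_div_pos.2 hp0).le hexp (add_sub_cancel _ _)
  simp only [← ENNReal.rpow_mul, mul_one_div_cancel hp0.ne', ENNReal.rpow_one, ENNReal.one_rpow,
    mul_one, lintegral_one] at holder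
  calc (∫⁻ x, φ x ∂μ) ^ p ≤ ((∫⁻ x, φ x ^ p ∂μ) ^ (1 / p) * μ univ ^ (1 - 1 / p)) ^ p := by gcongr
    _ = μ univ ^ (p - 1) * ∫⁻ x, φ x ^ p ∂μ := by
      rw [ENNReal.mul_rpow_of_nonneg _ _ hp0.le, ← ENNReal.rpow_mul, ← ENNReal.rpow_mul,
        one_div_mul_cancel hp0.ne', ENNReal.rpow_one, mul_comm, sub_mul, one_mul,
        one_div_mul_cancel hp0.ne']

end Moments

section Cosh

lemma pow_div_factorial_le_cosh_sub_one {j : ℕ} (hj : j ≠ 0) (y : ℝ) :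
    y ^ (2 * j) / (2 * j).factorial ≤ Real.cosh y - 1 := by
  have h := sum_le_hasSum {0, j}
    (fun i _ => div_nonneg ((even_two_mul i).pow_nonneg y) (by positivity)) (Real.hasSum_cosh y)
  rw [Finset.sum_pair hj.symm] at h
  simp only [mul_zero, pow_zero, Nat.factorial_zero, Nat.cast_one, div_one] at h
  linarith

lemma abs_rpow_le_sq_add_pow {p : ℝ} (hp : 2 ≤ p) {k : ℕ} (hk : p ≤ k) (y : ℝ) :
    |y| ^ p ≤ y ^ 2 + |y| ^ k := by
  rcases le_total |y| 1 with hy | hy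
  · calc |y| ^ p ≤ |y| ^ (2 : ℝ) :=
          Real.rpow_le_rpow_of_exponent_ge' (abs_nonneg y) hy zero_le_two hp
      _ = y ^ 2 := by rw [Real.rpow_two, sq_abs]
      _ ≤ y ^ 2 + |y| ^ k := le_add_of_nonneg_right (by positivity)
  · calc |y| ^ p ≤ |y| ^ (k : ℝ) := Real.rpow_le_rpow_of_exponent_le hy hk
      _ = |y| ^ k := Real.rpow_natCast _ _
      _ ≤ y ^ 2 + |y| ^ k := le_add_of_nonneg_left (sq_nonneg y)

lemma exists_abs_rpow_le_cosh {p : ℝ} (hp : 2 ≤ p) :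
    ∃ K : ℝ, 0 ≤ K ∧ ∀ y : ℝ, |y| ^ p ≤ K * (Real.cosh y - 1) := by
  obtain ⟨k, hk⟩ := exists_nat_ge p
  have hk0 : k ≠ 0 := by
    rintro rfl
    exact absurd (hp.trans hk) (by norm_num)
  refine ⟨2 + (2 * k).factorial, by positivity, fun y => ?_⟩
  have hsq := pow_div_factorial_le_cosh_sub_one one_ne_zero y
  have hpow := pow_div_factorial_le_cosh_sub_one hk0 y
  have habs := abs_rpow_le_sq_add_pow hp (k := 2 * k) (by push_cast; linarith) y
  rw [(even_two_mul k).pow_abs] at habs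
  rw [div_le_iff₀ (by positivity)] at hsq hpow
  norm_num at hsq
  linarith

end Cosh

namespace IsGammaProcess

variable {Ω : Type*} [MeasurableSpace Ω] {P : Measure Ω} {S : ℝ≥0 → Ω → ℝ}

section ExponentialBound

variable {c : ℝ} {g : ℝ → ℝ}

lemma integral_exp_compensatedIntegral (hS : IsGammaProcess S P) (hc : c < 1)
    (hgm : Measurable g) (hg : ∀ x, |g x| ≤ c) (T : ℝ≥0) :
    ∫ ω, Real.exp (compensatedIntegral S g T ω) ∂P
      = Real.exp (-(∫ x in Ioc 0 (T : ℝ), Real.log (1 - g x)) - lam g T) := by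
  simp_rw [compensatedIntegral, sub_eq_add_neg _ (lam g T), Real.exp_add]
  rw [integral_mul_const, hS.integral_exp_gammaIntegral hc hgm hg]

lemma integrable_exp_compensatedIntegral (hS : IsGammaProcess S P) (hc : c < 1)
    (hgm : Measurable g) (hg : ∀ x, |g x| ≤ c) (T : ℝ≥0) :
    Integrable (fun ω => Real.exp (compensatedIntegral S g T ω)) P :=
  Integrable.of_integral_ne_zero
    ((hS.integral_exp_compensatedIntegral hc hgm hg T).trans_ne (Real.exp_pos _).ne')

lemma integral_exp_compensatedIntegral_le (hS : IsGammaProcess S P) (hc : c < 1)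
    (hgm : Measurable g) (hg : ∀ x, |g x| ≤ c) (T : ℝ≥0) :
    ∫ ω, Real.exp (compensatedIntegral S g T ω) ∂P
      ≤ Real.exp ((∫ x in Ioc 0 (T : ℝ), g x ^ 2) / (1 - c)) := by
  have hint : IntegrableOn g (Ioc 0 T) :=
    Measure.integrableOn_of_bounded (by simp) hgm.aestronglyMeasurable (ae_of_all _ hg)
  have hint2 : IntegrableOn (fun x => g x ^ 2) (Ioc 0 T) :=
    Measure.integrableOn_of_bounded (M := c ^ 2) (by simp) (hgm.pow_const 2).aestronglyMeasurable
      (ae_of_all _ fun x => (norm_pow _ _).trans_le (pow_le_pow_left₀ (norm_nonneg _) (hg x) 2))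
  have hlog : IntegrableOn (fun x => -Real.log (1 - g x)) (Ioc 0 T) :=
    Measure.integrableOn_of_bounded (by simp) (hgm.const_sub 1).log.neg.aestronglyMeasurable
      (ae_of_all _ fun x => (norm_neg _).trans_le (abs_log_one_sub_le (hg x) hc))
  rw [hS.integral_exp_compensatedIntegral hc hgm hg, Real.exp_le_exp, sub_le_iff_le_add', lam,
    ← integral_neg, ← integral_div, ← integral_add hint (hint2.div_const _)]
  exact integral_mono hlog (hint.add (hint2.div_const _)) fun x => neg_log_one_sub_le (hg x) hc

lemma integrable_exp_neg_compensatedIntegral (hS : IsGammaProcess S P) (hc : c < 1)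
    (hgm : Measurable g) (hg : ∀ x, |g x| ≤ c) (T : ℝ≥0) :
    Integrable (fun ω => Real.exp (-compensatedIntegral S g T ω)) P := by
  simpa only [compensatedIntegral_neg] using
    hS.integrable_exp_compensatedIntegral hc hgm.neg (fun x => (abs_neg _).trans_le (hg x)) T

lemma integral_exp_neg_compensatedIntegral_le (hS : IsGammaProcess S P) (hc : c < 1)
    (hgm : Measurable g) (hg : ∀ x, |g x| ≤ c) (T : ℝ≥0) :
    ∫ ω, Real.exp (-compensatedIntegral S g T ω) ∂P
      ≤ Real.exp ((∫ x in Ioc 0 (T : ℝ), g x ^ 2) / (1 - c)) := by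
  simpa only [compensatedIntegral_neg, Pi.neg_apply, neg_sq] using
    hS.integral_exp_compensatedIntegral_le hc hgm.neg (fun x => (abs_neg _).trans_le (hg x)) T

lemma integrable_cosh_compensatedIntegral (hS : IsGammaProcess S P) (hc : c < 1)
    (hgm : Measurable g) (hg : ∀ x, |g x| ≤ c) (T : ℝ≥0) :
    Integrable (fun ω => Real.cosh (compensatedIntegral S g T ω)) P := by
  simp_rw [Real.cosh_eq]
  exact ((hS.integrable_exp_compensatedIntegral hc hgm hg T).add
    (hS.integrable_exp_neg_compensatedIntegral hc hgm hg T)).div_const 2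

lemma integral_cosh_compensatedIntegral_le (hS : IsGammaProcess S P) (hc : c < 1)
    (hgm : Measurable g) (hg : ∀ x, |g x| ≤ c) (T : ℝ≥0) :
    ∫ ω, Real.cosh (compensatedIntegral S g T ω) ∂P
      ≤ Real.exp ((∫ x in Ioc 0 (T : ℝ), g x ^ 2) / (1 - c)) := by
  simp_rw [Real.cosh_eq]
  rw [integral_div, integral_add (hS.integrable_exp_compensatedIntegral hc hgm hg T)
    (hS.integrable_exp_neg_compensatedIntegral hc hgm hg T)]
  linarith [hS.integral_exp_compensatedIntegral_le hc hgm hg T,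
    hS.integral_exp_neg_compensatedIntegral_le hc hgm hg T]

lemma lintegral_enorm_compensatedIntegral_rpow_le (hS : IsGammaProcess S P) (hc : c < 1)
    (hgm : Measurable g) (hg : ∀ x, |g x| ≤ c) (T : ℝ≥0) {p K : ℝ} (hp : 0 ≤ p) (hK : 0 ≤ K)
    (hpK : ∀ y : ℝ, |y| ^ p ≤ K * (Real.cosh y - 1)) :
    ∫⁻ ω, ‖compensatedIntegral S g T ω‖ₑ ^ p ∂P
      ≤ ENNReal.ofReal (K * (Real.exp ((∫ x in Ioc 0 (T : ℝ), g x ^ 2) / (1 - c)) - 1)) := by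
  have := hS.isProbabilityMeasure
  set Y := compensatedIntegral S g T
  have hcosh : Integrable (fun ω => Real.cosh (Y ω)) P :=
    hS.integrable_cosh_compensatedIntegral hc hgm hg T
  have hnonneg (ω : Ω) : 0 ≤ K * (Real.cosh (Y ω) - 1) :=
    mul_nonneg hK (sub_nonneg.2 (Real.one_le_cosh _))
  calc ∫⁻ ω, ‖Y ω‖ₑ ^ p ∂P
      ≤ ∫⁻ ω, ENNReal.ofReal (K * (Real.cosh (Y ω) - 1)) ∂P := lintegral_mono fun ω => by
        rw [Real.enorm_eq_ofReal_abs, ENNReal.ofReal_rpow_of_nonneg (abs_nonneg _) hp]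
        exact ENNReal.ofReal_le_ofReal (hpK _)
    _ = ENNReal.ofReal (K * ((∫ ω, Real.cosh (Y ω) ∂P) - 1)) := by
        have hint : Integrable (fun ω => K * (Real.cosh (Y ω) - 1)) P :=
          (hcosh.sub (integrable_const 1)).const_mul K
        rw [← ofReal_integral_eq_lintegral_ofReal hint (ae_of_all _ hnonneg), integral_const_mul,
          integral_sub hcosh (integrable_const 1), integral_const, probReal_univ, one_smul]
    _ ≤ _ := by
        gcongr
        exact hS.integral_cosh_compensatedIntegral_le hc hgm hg T

end ExponentialBound

section Convergence

variable {ι : Type*} {l : Filter ι} {T : ι → ℝ≥0} {g : ι → ℝ → ℝ} {c p : ℝ}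

lemma tendsto_eLpNorm_compensatedIntegral_of_le_lt_one (hS : IsGammaProcess S P) (hp : 2 ≤ p)
    (hc : c < 1) (hgm : ∀ i, Measurable (g i)) (hg : ∀ i x, |g i x| ≤ c)
    (hlim : Tendsto (fun i => ∫ x in Ioc 0 (T i : ℝ), g i x ^ 2) l (𝓝 0)) :
    Tendsto (fun i => eLpNorm (compensatedIntegral S (g i) (T i)) (ENNReal.ofReal p) P) l
      (𝓝 0) := by
  obtain ⟨K, hK, hpK⟩ := exists_abs_rpow_le_cosh hp
  have hp0 : 0 < p := two_pos.trans_le hp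
  have hbound : Continuous fun y : ℝ => ENNReal.ofReal (K * (Real.exp (y / (1 - c)) - 1)) :=
    ENNReal.continuous_ofReal.comp (by fun_prop)
  have hmoment : Tendsto (fun i => ∫⁻ ω, ‖compensatedIntegral S (g i) (T i) ω‖ₑ ^ p ∂P) l
      (𝓝 0) :=
    tendsto_of_tendsto_of_tendsto_of_le_of_le tendsto_const_nhds
      (by simpa [Function.comp_def] using (hbound.tendsto 0).comp hlim) (fun _ => zero_le)
      fun i => hS.lintegral_enorm_compensatedIntegral_rpow_le hc (hgm i) (hg i) (T i) hp0.le hK hpK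
  refine (tendsto_rpow_nhds_zero_iff hp0).1 (hmoment.congr fun i => ?_)
  rw [eLpNorm_ofReal_rpow _ hp0]

lemma tendsto_eLpNorm_compensatedIntegral (hS : IsGammaProcess S P) (hp : 2 ≤ p)
    (hgm : ∀ i, Measurable (g i)) (hg : ∀ i x, |g i x| ≤ c)
    (hlim : Tendsto (fun i => ∫ x in Ioc 0 (T i : ℝ), g i x ^ 2) l (𝓝 0)) :
    Tendsto (fun i => eLpNorm (compensatedIntegral S (g i) (T i)) (ENNReal.ofReal p) P) l
      (𝓝 0) := by
  have hscale : 0 < |c| + 1 := by positivity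
  have hsmall := hS.tendsto_eLpNorm_compensatedIntegral_of_le_lt_one hp
    (c := |c| / (|c| + 1)) ((div_lt_one hscale).2 (lt_add_one _)) (T := T)
    (g := fun i x => (|c| + 1)⁻¹ * g i x) (fun i => (hgm i).const_mul _)
    (fun i x => by
      rw [abs_mul, abs_inv, abs_of_pos hscale, inv_mul_eq_div]
      exact div_le_div_of_nonneg_right ((hg i x).trans (le_abs_self c)) hscale.le)
    (by simpa only [mul_pow, integral_const_mul, mul_zero] using hlim.const_mul (((|c| + 1)⁻¹) ^ 2))
  have hrescale := ENNReal.Tendsto.const_mul (a := ‖|c| + 1‖ₑ) hsmall (Or.inr enorm_ne_top)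
  rw [mul_zero] at hrescale
  refine hrescale.congr fun i => ?_
  rw [compensatedIntegral_const_mul, ← eLpNorm_const_smul, smul_inv_smul₀ hscale.ne']

end Convergence

end IsGammaProcess

namespace IsGammaProcess

variable {Ω : Type*} [MeasurableSpace Ω] {P : Measure Ω} {S : ℝ≥0 → Ω → ℝ} {T : ℝ≥0}

section Integrability

variable {p : ℝ} {f : ℝ → ℝ}

lemma lintegral_ofReal_rpow_lt_top (hS : IsGammaProcess S P) {t : ℝ≥0} (ht : 0 < t)
    (hp : 0 ≤ p) : ∫⁻ ω, ENNReal.ofReal (S t ω) ^ p ∂P < ∞ := by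
  have hlaw := hS.hasLaw ht
  calc ∫⁻ ω, ENNReal.ofReal (S t ω) ^ p ∂P
      = ∫⁻ x, ENNReal.ofReal x ^ p ∂(gammaMeasure t 1) :=
        hlaw.lintegral_comp (f := fun x => ENNReal.ofReal x ^ p) (by fun_prop)
    _ ≤ ∫⁻ x, ENNReal.ofReal (|x| ^ p) ∂(gammaMeasure t 1) := lintegral_mono fun x => by
        rw [← ENNReal.ofReal_rpow_of_nonneg (abs_nonneg x) hp]
        gcongr
        exact le_abs_self x
    _ < ∞ := (integrable_abs_rpow_gammaMeasure (NNReal.coe_pos.2 ht) one_pos hp).lintegral_lt_top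

lemma ae_enorm_gammaIntegral_rpow_le (hS : IsGammaProcess S P) (hp : 1 ≤ p) (hf : Measurable f)
    (T : ℝ≥0) :
    ∀ᵐ ω ∂P, ‖gammaIntegral S f T ω‖ₑ ^ p
      ≤ ENNReal.ofReal (S T ω) ^ (p - 1) * gammaLIntegral S (fun x => ‖f x‖ₑ ^ p) T ω := by
  filter_upwards [hS.pathMeasure_Ioc_ae_eq 0 T, hS.zero] with ω hω h0
  rw [h0, sub_zero, NNReal.coe_zero] at hω
  calc ‖gammaIntegral S f T ω‖ₑ ^ p
      ≤ (∫⁻ x in Ioc 0 (T : ℝ), ‖f x‖ₑ ∂(pathMeasure fun r => S r ω)) ^ p := by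
        gcongr
        exact enorm_integral_le_lintegral_enorm _
    _ ≤ _ := by
        rw [← hω, ← Measure.restrict_apply_univ]
        exact lintegral_rpow_le_measure_univ_rpow_mul hf.enorm.aemeasurable hp

lemma memLp_gammaIntegral (hS : IsGammaProcess S P) (hp : 1 ≤ p) (hf : Measurable f)
    (hfp : MemLp f (ENNReal.ofReal p) (volume.restrict (Ioc 0 (T : ℝ)))) :
    MemLp (gammaIntegral S f T) (ENNReal.ofReal p) P := by
  have hp0 : 0 < p := one_pos.trans_le hp
  have hfint : IntegrableOn f (Ioc 0 T) := hfp.integrable (ENNReal.one_le_ofReal.2 hp)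
  have hweight : ∫⁻ ω, ENNReal.ofReal (S (T + 1) ω) ^ (p - 1) ∂P < ∞ :=
    hS.lintegral_ofReal_rpow_lt_top (by positivity) (sub_nonneg.2 hp)
  refine ⟨(hS.aemeasurable_gammaIntegral hf hfint).aestronglyMeasurable, ?_⟩
  rw [← ENNReal.rpow_lt_top_iff_of_pos hp0, eLpNorm_ofReal_rpow _ hp0]
  calc ∫⁻ ω, ‖gammaIntegral S f T ω‖ₑ ^ p ∂P
      ≤ ∫⁻ ω, ENNReal.ofReal (S T ω) ^ (p - 1) * gammaLIntegral S (fun x => ‖f x‖ₑ ^ p) T ω ∂P :=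
        lintegral_mono_ae (hS.ae_enorm_gammaIntegral_rpow_le hp hf T)
    _ = (∫⁻ ω, ENNReal.ofReal (S (T + 1) ω) ^ (p - 1) ∂P)
          * ∫⁻ x in Ioc 0 (T : ℝ), ‖f x‖ₑ ^ p :=
        hS.lintegral_comp_mul_gammaLIntegral T (φ := fun x => ENNReal.ofReal x ^ (p - 1))
          (by fun_prop) hweight.ne (by fun_prop)
    _ < ∞ := by
        rw [← eLpNorm_ofReal_rpow f hp0]
        exact ENNReal.mul_lt_top hweight (ENNReal.rpow_lt_top_of_nonneg hp0.le hfp.2.ne)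

end Integrability

section OrderlyDivergence

variable {f : ℝ → ℝ}

lemma eLpNorm_R_sub_one_rpow_two (hS : IsGammaProcess S P) (hfm : Measurable f)
    (hf : ∀ x ∈ Ioc 0 (T : ℝ), 0 ≤ f x) (hfi : IntegrableOn f (Ioc 0 T)) (hT : lam f T ≠ 0) :
    eLpNorm (fun ω => R S f T ω - 1) (ENNReal.ofReal 2) P ^ (2 : ℝ) = v f T := by
  rw [R_sub_one_eq_smul_compensatedIntegral S hT, eLpNorm_const_smul,
    ENNReal.mul_rpow_of_nonneg _ _ zero_le_two, eLpNorm_ofReal_rpow _ two_pos]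
  simp only [ENNReal.rpow_ofNat]
  rw [hS.lintegral_enorm_compensatedIntegral_sq hfm hf hfi, v, ENNReal.div_eq_inv_mul,
    enorm_inv hT, ← ENNReal.inv_pow, Real.enorm_eq_ofReal_abs, ← ENNReal.ofReal_pow (abs_nonneg _),
    sq_abs]

theorem odLp_two_iff (hS : IsGammaProcess S P) (hfm : Measurable f)
    (hf : ∀ x, 0 ≤ x → 0 ≤ f x) (hloc : ∀ t, IntegrableOn f (Ioc 0 t))
    (hdiv : Tendsto (lam f) atTop atTop) :
    ODLp S P f 2 ↔ Tendsto (v f) atTop (𝓝 0) := by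
  have := hS.isProbabilityMeasure
  have hnorm : ∀ᶠ t in atTop,
      eLpNorm (fun ω => R S f t ω - 1) (ENNReal.ofReal 2) P ^ (2 : ℝ) = v f t := by
    filter_upwards [hdiv.eventually_ne_atTop 0, eventually_ge_atTop 0] with t hlam ht
    lift t to ℝ≥0 using ht
    exact hS.eLpNorm_R_sub_one_rpow_two hfm (fun x hx => hf x hx.1.le) (hloc t) hlam
  rw [← tendsto_congr' hnorm, tendsto_rpow_nhds_zero_iff two_pos, ODLp]
  refine and_iff_right_of_imp fun hlim => ?_
  filter_upwards [hlim.eventually_lt_const ENNReal.zero_lt_top, eventually_ge_atTop 0]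
    with t hfin ht
  lift t to ℝ≥0 using ht
  have hR : AEStronglyMeasurable (R S f t) P :=
    ((hS.aemeasurable_gammaIntegral hfm (hloc t)).div_const _).aestronglyMeasurable
  have hcentered : MemLp (fun ω => R S f t ω - 1) (ENNReal.ofReal 2) P :=
    ⟨hR.sub aestronglyMeasurable_const, hfin⟩
  simpa [Pi.add_def] using hcentered.add (memLp_const 1)

end OrderlyDivergence

end IsGammaProcess

/-- The function `f / λ_t f` restricted to `(a, t]`: for a large starting time `a` it is bounded
uniformly in `t` as soon as `b f` is bounded near infinity. -/
noncomputable def normalizedTail (f : ℝ → ℝ) (a t : ℝ) : ℝ → ℝ :=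
  (Ioc a t).indicator fun x => f x / lam f t

section NormalizedTail

variable {f : ℝ → ℝ} {a t : ℝ}

lemma measurable_normalizedTail (hf : Measurable f) (a t : ℝ) :
    Measurable (normalizedTail f a t) :=
  (hf.div_const _).indicator measurableSet_Ioc

lemma monotone_lam (hf : ∀ x, 0 ≤ x → 0 ≤ f x) (hloc : ∀ t, IntegrableOn f (Ioc 0 t)) :
    Monotone (lam f) := fun _ t hst =>
  setIntegral_mono_set (hloc t) ((ae_restrict_iff' measurableSet_Ioc).2
    (ae_of_all _ fun x hx => hf x hx.1.le)) (Ioc_subset_Ioc_right hst).eventuallyLE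

lemma abs_normalizedTail_le {C : ℝ} (hf : ∀ x, 0 ≤ x → 0 ≤ f x)
    (hloc : ∀ t, IntegrableOn f (Ioc 0 t)) (ha : 0 ≤ a) (hpos : 0 < lam f a)
    (hb : ∀ t, a ≤ t → b f t ≤ C) (t x : ℝ) : |normalizedTail f a t x| ≤ C := by
  have hlam {s : ℝ} (hs : a ≤ s) : 0 < lam f s := hpos.trans_le (monotone_lam hf hloc hs)
  by_cases hx : x ∈ Ioc a t
  · have hfx : 0 ≤ f x := hf x (ha.trans hx.1.le)
    have hlamt : 0 < lam f t := hlam (hx.1.le.trans hx.2)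
    have hlamx : 0 < lam f x := hlam hx.1.le
    rw [normalizedTail, indicator_of_mem hx, abs_of_nonneg (by positivity)]
    calc f x / lam f t ≤ f x / lam f x := by
          gcongr
          exact monotone_lam hf hloc hx.2
      _ ≤ C := hb x hx.1.le
  · rw [normalizedTail, indicator_of_notMem hx, abs_zero]
    exact (div_nonneg (hf a ha) hpos.le).trans (hb a le_rfl)

lemma setIntegral_normalizedTail {μ : Measure ℝ} (ha : 0 ≤ a) (hat : a ≤ t)
    (hf : IntegrableOn f (Ioc 0 t) μ) :
    ∫ x in Ioc 0 t, normalizedTail f a t x ∂μ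
      = ((∫ x in Ioc 0 t, f x ∂μ) - ∫ x in Ioc 0 a, f x ∂μ) / lam f t := by
  have hsplit : Ioc 0 t \ Ioc 0 a = Ioc a t := by
    ext x
    simp only [Set.mem_sdiff, mem_Ioc]
    grind
  rw [normalizedTail, setIntegral_indicator measurableSet_Ioc,
    inter_eq_right.2 (Ioc_subset_Ioc_left ha), integral_div, ← hsplit,
    setIntegral_sdiff measurableSet_Ioc hf (Ioc_subset_Ioc_right hat)]

lemma lintegral_normalizedTail_sq_le_v (ht : lam f t ≠ 0) :
    ∫⁻ x in Ioc 0 t, ENNReal.ofReal (normalizedTail f a t x ^ 2) ≤ v f t := by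
  have hle (x : ℝ) : ENNReal.ofReal (normalizedTail f a t x ^ 2)
      ≤ (ENNReal.ofReal (lam f t ^ 2))⁻¹ * ENNReal.ofReal (f x ^ 2) := by
    rw [← ENNReal.ofReal_inv_of_pos (by positivity), ← ENNReal.ofReal_mul (by positivity),
      inv_mul_eq_div, ← div_pow]
    refine ENNReal.ofReal_le_ofReal (sq_le_sq.2 ?_)
    exact norm_indicator_le_norm_self (s := Ioc a t) (fun x => f x / lam f t) x
  refine (lintegral_mono hle).trans_eq ?_
  rw [lintegral_const_mul' _ _ (by simpa using by positivity), v, ENNReal.div_eq_inv_mul]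

lemma tendsto_integral_normalizedTail_sq (hfm : Measurable f)
    (hdiv : Tendsto (lam f) atTop atTop) (hv : Tendsto (v f) atTop (𝓝 0)) (a : ℝ) :
    Tendsto (fun t => ∫ x in Ioc 0 t, normalizedTail f a t x ^ 2) atTop (𝓝 0) := by
  have hlim : Tendsto (fun t => ∫⁻ x in Ioc 0 t, ENNReal.ofReal (normalizedTail f a t x ^ 2))
      atTop (𝓝 0) := by
    refine tendsto_of_tendsto_of_tendsto_of_le_of_le' tendsto_const_nhds hv
      (Eventually.of_forall fun _ => zero_le) ?_
    filter_upwards [hdiv.eventually_ne_atTop 0] with t ht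
    exact lintegral_normalizedTail_sq_le_v ht
  refine ((ENNReal.tendsto_toReal ENNReal.zero_ne_top).comp hlim).congr fun t => ?_
  exact (setIntegral_eq_toReal_setLIntegral measurableSet_Ioc
    ((measurable_normalizedTail hfm a t).pow_const 2) fun x _ => sq_nonneg _).symm

end NormalizedTail

namespace IsGammaProcess

variable {Ω : Type*} [MeasurableSpace Ω] {P : Measure Ω} {S : ℝ≥0 → Ω → ℝ} {f : ℝ → ℝ} {p : ℝ}

lemma R_sub_one_ae_eq (hS : IsGammaProcess S P) (hfm : Measurable f) {a t : ℝ≥0} (hat : a ≤ t)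
    (hfi : IntegrableOn f (Ioc 0 t)) (ht : lam f t ≠ 0) :
    (fun ω => R S f t ω - 1) =ᵐ[P] (lam f t)⁻¹ • compensatedIntegral S f a
      + compensatedIntegral S (normalizedTail f a t) t := by
  have ha : (0 : ℝ) ≤ a := a.coe_nonneg
  have hat' : (a : ℝ) ≤ t := NNReal.coe_le_coe.2 hat
  filter_upwards [hS.ae_integrableOn_pathMeasure hfm hfi] with ω hω
  rw [Pi.add_apply, Pi.smul_apply, compensatedIntegral, compensatedIntegral, gammaIntegral,
    gammaIntegral, lam.eq_def (normalizedTail f a t), setIntegral_normalizedTail ha hat' hω,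
    setIntegral_normalizedTail ha hat' hfi, R, gammaIntegral, smul_eq_mul, ← lam, ← lam]
  field_simp
  ring

lemma tendsto_eLpNorm_inv_lam_smul {X : Ω → ℝ} (hX : MemLp X (ENNReal.ofReal p) P)
    (hdiv : Tendsto (lam f) atTop atTop) :
    Tendsto (fun t => eLpNorm ((lam f t)⁻¹ • X) (ENNReal.ofReal p) P) atTop (𝓝 0) := by
  have hinv : Tendsto (fun t => ‖(lam f t)⁻¹‖ₑ) atTop (𝓝 0) := by
    simpa using hdiv.inv_tendsto_atTop.enorm
  simpa [eLpNorm_const_smul] using ENNReal.Tendsto.mul_const hinv (Or.inr hX.2.ne)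

lemma tendsto_eLpNorm_compensatedIntegral_normalizedTail (hS : IsGammaProcess S P) (hp : 2 ≤ p)
    (hfm : Measurable f) (hdiv : Tendsto (lam f) atTop atTop) (hv : Tendsto (v f) atTop (𝓝 0))
    {a C : ℝ} (hC : ∀ t x, |normalizedTail f a t x| ≤ C) :
    Tendsto (fun t => eLpNorm (compensatedIntegral S (normalizedTail f a t) t)
      (ENNReal.ofReal p) P) atTop (𝓝 0) := by
  have hcoe : ∀ᶠ t : ℝ in atTop, (t.toNNReal : ℝ) = t := by
    filter_upwards [eventually_ge_atTop 0] with t ht using Real.coe_toNNReal t ht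
  have hlim := hS.tendsto_eLpNorm_compensatedIntegral hp (T := Real.toNNReal)
    (g := normalizedTail f a) (measurable_normalizedTail hfm a) hC
    ((tendsto_integral_normalizedTail_sq hfm hdiv hv a).congr' (hcoe.mono fun t ht => by
      simp only [ht]))
  exact hlim.congr' (hcoe.mono fun t ht => by rw [ht])

lemma tendsto_eLpNorm_R_sub_one (hS : IsGammaProcess S P) (hp : 2 ≤ p) (hfm : Measurable f)
    (hf : ∀ x, 0 ≤ x → 0 ≤ f x) (hloc : ∀ t, IntegrableOn f (Ioc 0 t))
    (hdiv : Tendsto (lam f) atTop atTop) (hv : Tendsto (v f) atTop (𝓝 0)) {a : ℝ≥0} {C : ℝ}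
    (ha : 0 < lam f a) (hb : ∀ t, (a : ℝ) ≤ t → b f t ≤ C)
    (hfa : MemLp f (ENNReal.ofReal p) (volume.restrict (Ioc 0 (a : ℝ)))) :
    Tendsto (fun t => eLpNorm (fun ω => R S f t ω - 1) (ENNReal.ofReal p) P) atTop (𝓝 0) := by
  have := hS.isProbabilityMeasure
  have hp1 : 1 ≤ p := one_le_two.trans hp
  have hgm (t : ℝ) : Measurable (normalizedTail f a t) := measurable_normalizedTail hfm a t
  have hgC : ∀ t x, |normalizedTail f a t x| ≤ C := abs_normalizedTail_le hf hloc a.coe_nonneg ha hb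
  have hhead : MemLp (compensatedIntegral S f a) (ENNReal.ofReal p) P :=
    (hS.memLp_gammaIntegral hp1 hfm hfa).sub (memLp_const _)
  have hlim := (tendsto_eLpNorm_inv_lam_smul hhead hdiv).add
    (hS.tendsto_eLpNorm_compensatedIntegral_normalizedTail hp hfm hdiv hv hgC)
  rw [add_zero] at hlim
  refine tendsto_of_tendsto_of_tendsto_of_le_of_le' tendsto_const_nhds hlim
    (Eventually.of_forall fun _ => zero_le) ?_
  filter_upwards [eventually_ge_atTop (a : ℝ)] with t hat
  lift t to ℝ≥0 using a.coe_nonneg.trans hat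
  have hgi : IntegrableOn (normalizedTail f a t) (Ioc 0 t) :=
    Measure.integrableOn_of_bounded (by simp) (hgm t).aestronglyMeasurable (ae_of_all _ (hgC t))
  rw [eLpNorm_congr_ae (hS.R_sub_one_ae_eq hfm hat (hloc t)
    (ha.trans_le (monotone_lam hf hloc hat)).ne')]
  exact eLpNorm_add_le (hhead.1.const_smul _)
    (hS.aemeasurable_compensatedIntegral (hgm t) hgi).aestronglyMeasurable
    (ENNReal.one_le_ofReal.2 hp1)

theorem odLp_of_tendsto_v (hS : IsGammaProcess S P) (hp : 2 ≤ p) (hfm : Measurable f)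
    (hf : ∀ x, 0 ≤ x → 0 ≤ f x) (hloc : ∀ t, IntegrableOn f (Ioc 0 t))
    (hdiv : Tendsto (lam f) atTop atTop) (hb : ∃ C t₀ : ℝ, ∀ t, t₀ ≤ t → b f t ≤ C)
    (hv : Tendsto (v f) atTop (𝓝 0))
    (hfp : ∀ t, MemLp f (ENNReal.ofReal p) (volume.restrict (Ioc 0 t))) : ODLp S P f p := by
  obtain ⟨C, t₀, hC⟩ := hb
  obtain ⟨a, ⟨ha0, ha⟩, hat₀⟩ := (((eventually_ge_atTop 0).and
    (hdiv.eventually_gt_atTop 0)).and (eventually_ge_atTop t₀)).exists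
  lift a to ℝ≥0 using ha0
  refine ⟨?_, hS.tendsto_eLpNorm_R_sub_one hp hfm hf hloc hdiv hv ha
    (fun t ht => hC t (hat₀.trans ht)) (hfp a)⟩
  filter_upwards [eventually_ge_atTop 0] with t ht
  lift t to ℝ≥0 using ht
  change MemLp (fun ω => gammaIntegral S f t ω / lam f t) (ENNReal.ofReal p) P
  simpa only [div_eq_mul_inv] using
    (hS.memLp_gammaIntegral (one_le_two.trans hp) hfm (hfp t)).mul_const (lam f t)⁻¹

end IsGammaProcess

end OrderlyDivergence

theorem mainTheorem5_general {Ω : Type*} [MeasurableSpace Ω] (P : Measure Ω)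
    (S : ℝ≥0 → Ω → ℝ) (hS : OrderlyDivergence.IsGammaProcess S P)
    (f : ℝ → ℝ) (hfm : Measurable f) (hf : ∀ x, 0 ≤ x → 0 ≤ f x)
    (hloc : ∀ t, IntegrableOn f (Ioc 0 t))
    (hdiv : Tendsto (OrderlyDivergence.lam f) atTop atTop) :
    (OrderlyDivergence.ODLp S P f 2 ↔ Tendsto (OrderlyDivergence.v f) atTop (𝓝 0)) ∧
    ((∃ C t₀ : ℝ, ∀ t, t₀ ≤ t → OrderlyDivergence.b f t ≤ C) →
      OrderlyDivergence.ODLp S P f 2 →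
        ∀ p : ℝ, 2 ≤ p →
          (∀ t, MemLp f (ENNReal.ofReal p) (volume.restrict (Ioc 0 t))) →
          OrderlyDivergence.ODLp S P f p) :=
  have hiff := hS.odLp_two_iff hfm hf hloc hdiv
  ⟨hiff, fun hb hOD _ hp hfp =>
    hS.odLp_of_tendsto_v hp hfm hf hloc hdiv hb (hiff.1 hOD) hfp⟩

theorem mainTheorem5 {Ω : Type*} [MeasurableSpace Ω] (P : Measure Ω) [IsProbabilityMeasure P]
    (S : ℝ≥0 → Ω → ℝ) (hS : OrderlyDivergence.IsGammaProcess S P)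
    (f : ℝ → ℝ) (hfm : Measurable f) (hf : ∀ x, 0 ≤ x → 0 ≤ f x)
    (hloc : ∀ t, IntegrableOn f (Ioc 0 t))
    (hdiv : Tendsto (OrderlyDivergence.lam f) atTop atTop)
    (hb : ∃ C t₀ : ℝ, ∀ t, t₀ ≤ t → OrderlyDivergence.b f t ≤ C) :
    (OrderlyDivergence.ODLp S P f 2 ↔ Tendsto (OrderlyDivergence.v f) atTop (𝓝 0)) ∧
    (OrderlyDivergence.ODLp S P f 2 →
      ∀ p : ℝ, 2 ≤ p →
        (∀ t, MemLp f (ENNReal.ofReal p) (volume.restrict (Ioc 0 t))) →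
        OrderlyDivergence.ODLp S P f p) :=
  have h := mainTheorem5_general P S hS f hfm hf hloc hdiv
  ⟨h.1, h.2 hb⟩
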